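/- Let $\mathcal X\subset\mathbb R^d$ be compact and let $\mathcal H_\kappa$ be a reproducing kernel Hilbert space of real functions on $\mathcal X$ whose kernel $\kappa$ is measurable and satisfies $\kappa(x,x')\le 1$ for all $x,x'\in\mathcal X$. Let $f\in\mathcal H_\kappa$ with $\|f\|_\kappa\le\mathcal B_f$, let $\rho:\mathcal X\to[\underline\varrho,\bar\varrho]$ with $0<\underline\varrho\le\bar\varrho$ be a known measurable function, and let $\alpha\ge 0$ and $\delta\in(0,1)$. Put $\mathrm{MV}(x)=f(x)-\alpha\rho^2(x)$ and assume that $\mathrm{MV}$ has a maximizer $x^*\in\mathcal X$. In round $t=1,2,\dots$ a learner chooses $x_t\in\mathcal X$ from the information available before round $t$ and then observes $y_t=f(x_t)+\xi_t(x_t)$. Here $\xi_t$ is a (jointly measurable) random function on $\mathcal X$, independent of all the information available before round $t$, and for each $x$ the variable $\xi_t(x)$ has mean zero and is $\rho(x)$-sub-Gaussian, i.e. $\mathbb E[e^{s\xi_t(x)}]\le e^{s^2\rho^2(x)/2}$ for all $s\in\mathbb R$. With $K_t=(\kappa(x_i,x_j))_{i,j\le t}$, $\Sigma_t=\mathrm{diag}(\rho^2(x_1),\dots,\rho^2(x_t))$,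 $\kappa_t(x)=(\kappa(x_1,x),\dots,\kappa(x_t,x))^\top$, $y_{1:t}=(y_1,\dots,y_t)^\top$ and $\lambda=1$, let $$\mu_t(x)=\kappa_t(x)^\top(K_t+\lambda\Sigma_t)^{-1}y_{1:t},\qquad \sigma_t^2(x)=\tfrac1\lambda\bigl(\kappa(x,x)-\kappa_t(x)^\top(K_t+\lambda\Sigma_t)^{-1}\kappa_t(x)\bigr),$$ $$w_t=\sqrt{2\ln\frac{\det(\lambda\Sigma_t+K_t)^{1/2}}{\delta\,\det(\lambda\Sigma_t)^{1/2}}}+\sqrt\lambda\,b ,$$ where $b$ is a fixed number with $\|f\|_\kappa\le b\le\mathcal B_f$ (for instance $b=\|f\|_\kappa$ or $b=\mathcal B_f$), and where quantities with index $0$ are computed from no data. Let either $\beta_t=w_t$ for all $t$, or $\beta_t=w_{t-1}$ for all $t$ (only the points known before round $t$ are used). Let $N\in\mathbb N\cup\{\infty\}$ and suppose that the learner follows RAHBO up to round $N$: almost surely, for every $1\le t\le N$, $$x_t\in\arg\max_{x\in\mathcal X}\ \mu_{t-1}(x)+\beta_t\,\sigma_{t-1}(x)-\alpha\rho^2(x).$$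 Let $R_T=\sum_{t=1}^T[\mathrm{MV}(x^*)-\mathrm{MV}(x_t)]$, and let $$\gamma_T=\sup_{(a_1,\dots,a_T)\in\mathcal X^T}\ \frac12\sum_{t=1}^T\ln\Bigl(1+\frac{\sigma_{t-1}^2(a_t)}{\rho^2(a_t)}\Bigr)$$ be the heteroscedastic maximum information gain, where $\sigma_{t-1}$ in the $t$-th term is computed from the points $a_1,\dots,a_{t-1}$. Then there is an absolute constant $C>0$ such that, with probability at least $1-\delta$, $$R_T\le C\,\beta_T\sqrt{T\,\gamma_T\,(\bar\varrho^2+1)}\qquad\text{for all } 1\le T\le N .$$ -/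

import Mathlib

open MeasureTheory ProbabilityTheory
open scoped Matrix ENNReal

noncomputable section

namespace RAHBO

/-! ### Gaussian-process posterior with heteroscedastic noise

Data at `n` rounds are a tuple of points `p : Fin n → 𝒳` together with a tuple of
observations `v : Fin n → ℝ`. Points may be repeated. -/

section Posterior

variable {𝒳 : Type*}

/-- The real-valued kernel `κ(x, x')` of a reproducing kernel Hilbert space `H` of real functions
on `𝒳`: Mathlib's kernel takes values in the operators `ℝ →L[ℝ] ℝ`, which are multiplications
by a number. -/
def scalarKernel (H : Type*) [NormedAddCommGroup H] [InnerProductSpace ℝ H] [CompleteSpace H]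
    [RKHS ℝ H 𝒳 ℝ] (x x' : 𝒳) : ℝ :=
  RKHS.kernel H x x' 1

/-- The kernel matrix `(K_n)_{ij} = κ(p_i, p_j)`. -/
def gram (κ : 𝒳 → 𝒳 → ℝ) {n : ℕ} (p : Fin n → 𝒳) : Matrix (Fin n) (Fin n) ℝ :=
  Matrix.of fun i j => κ (p i) (p j)

/-- The vector `κ_n(x) = (κ(p_1, x), …, κ(p_n, x))`. -/
def kvec (κ : 𝒳 → 𝒳 → ℝ) {n : ℕ} (p : Fin n → 𝒳) (x : 𝒳) : Fin n → ℝ :=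
  fun i => κ (p i) x

/-- The noise matrix `Σ_n = diag(ρ²(p_1), …, ρ²(p_n))`. -/
def noiseMat (ρ : 𝒳 → ℝ) {n : ℕ} (p : Fin n → 𝒳) : Matrix (Fin n) (Fin n) ℝ :=
  Matrix.diagonal fun i => ρ (p i) ^ 2

/-- The posterior mean `μ_n(x) = κ_n(x)ᵀ (K_n + λ Σ_n)⁻¹ v`. -/
def postMean (κ : 𝒳 → 𝒳 → ℝ) (ρ : 𝒳 → ℝ) (lam : ℝ) {n : ℕ} (p : Fin n → 𝒳) (v : Fin n → ℝ)
    (x : 𝒳) : ℝ :=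
  kvec κ p x ⬝ᵥ ((gram κ p + lam • noiseMat ρ p)⁻¹ *ᵥ v)

/-- The posterior variance
`σ_n²(x) = λ⁻¹ (κ(x, x) - κ_n(x)ᵀ (K_n + λ Σ_n)⁻¹ κ_n(x))`. -/
def postVar (κ : 𝒳 → 𝒳 → ℝ) (ρ : 𝒳 → ℝ) (lam : ℝ) {n : ℕ} (p : Fin n → 𝒳) (x : 𝒳) : ℝ :=
  1 / lam * (κ x x - kvec κ p x ⬝ᵥ ((gram κ p + lam • noiseMat ρ p)⁻¹ *ᵥ kvec κ p x))

/-- The posterior standard deviation `σ_n(x)`. -/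
def postStd (κ : 𝒳 → 𝒳 → ℝ) (ρ : 𝒳 → ℝ) (lam : ℝ) {n : ℕ} (p : Fin n → 𝒳) (x : 𝒳) : ℝ :=
  √(postVar κ ρ lam p x)

/-- The confidence width
`√(2 ln (det(λ Σ_n + K_n)^{1/2} / (δ det(λ Σ_n)^{1/2}))) + √λ b`
computed from the points `p`. -/
def confWidth (κ : 𝒳 → 𝒳 → ℝ) (ρ : 𝒳 → ℝ) (lam b δ : ℝ) {n : ℕ} (p : Fin n → 𝒳) : ℝ :=
  √(2 * Real.log (√((lam • noiseMat ρ p + gram κ p).det) / (δ * √((lam • noiseMat ρ p).det))))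
    + √lam * b

/-- The mutual information between the evaluations `y_{1:T}` and `f_{1:T}` at the points `p`
in the heteroscedastic Gaussian model:
`(1/2) ∑_{t=1}^T ln (1 + σ_{t-1}²(p_t) / ρ²(p_t))`, where `σ_{t-1}` is computed from the
first `t - 1` points. -/
def infoGain (κ : 𝒳 → 𝒳 → ℝ) (ρ : 𝒳 → ℝ) (lam : ℝ) {T : ℕ} (p : Fin T → 𝒳) : ℝ :=
  1 / 2 * ∑ t : Fin T,
    Real.log (1 + postVar κ ρ lam (fun i : Fin (t : ℕ) => p (i.castLE t.isLt.le)) (p t)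
      / ρ (p t) ^ 2)

/-- The maximum information gain `γ_T`, over all `T`-tuples of points. -/
def maxInfoGain (κ : 𝒳 → 𝒳 → ℝ) (ρ : 𝒳 → ℝ) (lam : ℝ) (T : ℕ) : ℝ :=
  ⨆ p : Fin T → 𝒳, infoGain κ ρ lam p

/-- The mean-variance objective `MV(x) = f(x) - α ρ²(x)`. -/
def meanVar (f ρ : 𝒳 → ℝ) (α : ℝ) (x : 𝒳) : ℝ :=
  f x - α * ρ x ^ 2

end Posterior

/-! ### Sampling and algorithm

Rounds are numbered `1, 2, …`; the values of the processes at index `0` play no role. -/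

section Interaction

variable {𝒳 Ω : Type*}

/-- The first `n` terms `(u_1, …, u_n)` of a process, at the outcome `ω`. -/
def firstTerms {A : Type*} (u : ℕ → Ω → A) (n : ℕ) (ω : Ω) : Fin n → A :=
  fun i => u (i + 1) ω

/-- The risk-averse cumulative regret `R_T = ∑_{t=1}^T (MV(x⋆) - MV(x_t))`. -/
def cumRegret (f ρ : 𝒳 → ℝ) (α : ℝ) (xstar : 𝒳) (x : ℕ → Ω → 𝒳) (T : ℕ) (ω : Ω) : ℝ :=
  ∑ t ∈ Finset.Icc 1 T, (meanVar f ρ α xstar - meanVar f ρ α (x t ω))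

/-- The sampling model `y_t = f(x_t) + ξ_t(x_t)`. Here `ℱ t` is the information of the learner
after round `t`, and `𝒩 t` is the σ-algebra of the noise of round `t`, which is independent of
everything the learner knew before that round. For every fixed `x`, the noise `ξ_t(x)` has mean
zero and is `ρ(x)`-sub-Gaussian; it need not have the same law in different rounds. -/
structure IsSampling [MeasurableSpace 𝒳] [mΩ : MeasurableSpace Ω] (P : Measure Ω)
    (f ρ : 𝒳 → ℝ) (ℱ : Filtration ℕ mΩ) (𝒩 : ℕ → MeasurableSpace Ω)
    (ξ : ℕ → 𝒳 → Ω → ℝ) (x : ℕ → Ω → 𝒳) (y : ℕ → Ω → ℝ) : Prop where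
  /-- The noise of a round is part of the probability space. -/
  noise_le : ∀ t : ℕ, 𝒩 (t + 1) ≤ mΩ
  /-- The random function `ξ_t` is jointly measurable in the point and the noise of round `t`. -/
  noise_measurable : ∀ t : ℕ,
    Measurable[MeasurableSpace.prod inferInstance (𝒩 (t + 1))] fun q : 𝒳 × Ω => ξ (t + 1) q.1 q.2
  /-- The noise of a round is independent of all that was known before it. -/
  noise_indep : ∀ t : ℕ, Indep (𝒩 (t + 1)) (ℱ t) P
  /-- The noise has mean zero. -/
  noise_mean : ∀ (t : ℕ) (z : 𝒳), ∫ ω, ξ (t + 1) z ω ∂P = 0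
  /-- `E[exp(s ξ_t(z))] ≤ exp(s² ρ²(z) / 2)` for all real `s`. -/
  noise_subgaussian : ∀ (t : ℕ) (z : 𝒳),
    HasSubgaussianMGF (ξ (t + 1) z) (Real.toNNReal (ρ z ^ 2)) P
  /-- The point of a round is chosen from the information of the earlier rounds. -/
  point_measurable : ∀ t : ℕ, Measurable[ℱ t] (x (t + 1))
  /-- The observation of a round is known after that round. -/
  obs_measurable : ∀ t : ℕ, Measurable[ℱ (t + 1)] (y (t + 1))
  /-- The observations. -/
  obs_eq : ∀ (t : ℕ) (ω : Ω), y (t + 1) ω = f (x (t + 1) ω) + ξ (t + 1) (x (t + 1) ω) ω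

/-- The acquisition function of a round, `μ_{t-1}(z) + β_t σ_{t-1}(z) - α ρ²(z)`, where
`p`, `v` are the points and observations of the rounds before. -/
def acquisition (κ : 𝒳 → 𝒳 → ℝ) (ρ : 𝒳 → ℝ) (α lam β : ℝ) {n : ℕ}
    (p : Fin n → 𝒳) (v : Fin n → ℝ) (z : 𝒳) : ℝ :=
  postMean κ ρ lam p v z + β * postStd κ ρ lam p z - α * ρ z ^ 2

/-- In every round `t ≤ N`, the point `x_t` maximizes `μ_{t-1} + β_t σ_{t-1} - α ρ²`. The horizon
`N` may be infinite. -/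
def IsRAHBO [MeasurableSpace Ω] (P : Measure Ω) (κ : 𝒳 → 𝒳 → ℝ) (ρ : 𝒳 → ℝ) (α lam : ℝ)
    (N : ℕ∞) (x : ℕ → Ω → 𝒳) (y β : ℕ → Ω → ℝ) : Prop :=
  ∀ t : ℕ, ((t + 1 : ℕ) : ℕ∞) ≤ N → ∀ᵐ ω ∂P, ∀ z : 𝒳,
    acquisition κ ρ α lam (β (t + 1) ω) (firstTerms x t ω) (firstTerms y t ω) z ≤
      acquisition κ ρ α lam (β (t + 1) ω) (firstTerms x t ω) (firstTerms y t ω) (x (t + 1) ω)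

/-- The parameters `β_t` are the confidence widths, computed either from the points
`x_1, …, x_t` (so that the selection rule for `x_t` is an implicit condition on `x_t`), or from
the points `x_1, …, x_{t-1}` that are known when `x_t` is selected. -/
def IsWidthSeq (κ : 𝒳 → 𝒳 → ℝ) (ρ : 𝒳 → ℝ) (lam b δ : ℝ) (x : ℕ → Ω → 𝒳)
    (β : ℕ → Ω → ℝ) : Prop :=
  (∀ (t : ℕ) (ω : Ω), β (t + 1) ω = confWidth κ ρ lam b δ (firstTerms x (t + 1) ω)) ∨
  (∀ (t : ℕ) (ω : Ω), β (t + 1) ω = confWidth κ ρ lam b δ (firstTerms x t ω))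

end Interaction

end RAHBO

end

/-!
The regret bound follows from optimism once `|μ_{t-1}(z) - f(z)| ≤ w_{t-1} σ_{t-1}(z)` holds for all
rounds `t` and all points `z` simultaneously. Then every round costs at most `2 β_t σ_{t-1}(x_t)`
(`meanVar_sub_le`); since `β` does not decrease, Cauchy-Schwarz leaves `∑ σ_{t-1}(x_t)²`, which
`v ≤ (ρ² + 1) ln (1 + v / ρ²)` for `0 ≤ v ≤ 1` turns into the information gain (`sum_postStd_le`).

The confidence bound has a deterministic and a probabilistic half. In terms of feature vectors
`φ(z)` with `κ(z, z') = ⟪φ(z), φ(z')⟫`, the posterior variance is the value of a ridge regression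
problem, and the self-normalized norm `Q` of the noise is an energy of the ridge
regression function fitted to the noise; Cauchy-Schwarz in `H × ℝⁿ` gives `|μ - f| ≤ (‖f‖ + √Q) σ`
(`abs_postMean_sub_le`).

For the probabilistic half, `√(det Σ / det (K + Σ)) exp (Q / 2)` is a supermartingale
(`mixtureValue`). Usually one integrates an exponential martingale over a Gaussian measure on
feature space. Here the mixture is taken one round at a time, which needs no measure on `H`: by
block elimination (`det_obsCov_succ`, `selfNorm_succ`) the factor gained in a round is the ratio of
the densities of the predictive law `N(m, ρ² + σ²)` and of `N(0, ρ²)` at the new noise `u`, and this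
ratio is a mixture of the weights `exp (θ u - θ² ρ² / 2)` over a real normal variable `θ`
(`lintegral_gaussian_mixture`). Each weight has mean at most one by sub-Gaussianity; the
independence of the new noise from the past, which fixes the point at which it is evaluated, lets
the past be frozen (`lintegral_diag_of_indep`). Ville's inequality (`mul_measure_exists_gt_le`) then
bounds the supermartingale by `1 / δ` at all times outside an event of probability at most `δ`, and
the logarithm of this bound gives the confidence width.
-/

namespace RAHBO

/-! ### Linear algebra of the regularized kernel matrix -/

section LinearAlgebra

variable {𝒳 H : Type*} [NormedAddCommGroup H] [InnerProductSpace ℝ H]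
  {κ : 𝒳 → 𝒳 → ℝ} {φ : 𝒳 → H} {ρ : 𝒳 → ℝ} {n : ℕ}

/-- The covariance matrix `K_n + Σ_n` of the observations at the points `p`. -/
noncomputable def obsCov (κ : 𝒳 → 𝒳 → ℝ) (ρ : 𝒳 → ℝ) {n : ℕ} (p : Fin n → 𝒳) :
    Matrix (Fin n) (Fin n) ℝ :=
  gram κ p + noiseMat ρ p

/-- The self-normalized norm `ηᵀ (Σ_n⁻¹ - (K_n + Σ_n)⁻¹) η` of a noise vector `η`. In feature space
it is the square of the norm of `∑ η_i ρ_i⁻² φ(p_i)` in the metric of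
`(1 + ∑ ρ_i⁻² φ(p_i) φ(p_i)ᵀ)⁻¹`. -/
noncomputable def selfNorm (κ : 𝒳 → 𝒳 → ℝ) (ρ : 𝒳 → ℝ) {n : ℕ} (p : Fin n → 𝒳) (η : Fin n → ℝ) :
    ℝ :=
  ∑ i, η i ^ 2 / ρ (p i) ^ 2 - η ⬝ᵥ ((obsCov κ ρ p)⁻¹ *ᵥ η)

/-- The linear combination `∑ b_i φ(p_i)` of feature vectors. -/
noncomputable def featureSum (φ : 𝒳 → H) (p : Fin n → 𝒳) (b : Fin n → ℝ) : H :=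
  ∑ i, b i • φ (p i)

lemma inner_featureSum_right (p : Fin n → 𝒳) (b : Fin n → ℝ) (h : H) :
    inner ℝ h (featureSum φ p b) = ∑ i, b i * inner ℝ h (φ (p i)) := by
  simp [featureSum, inner_sum, inner_smul_right]

lemma inner_featureSum_left (p : Fin n → 𝒳) (b : Fin n → ℝ) (h : H) :
    inner ℝ (featureSum φ p b) h = ∑ i, b i * inner ℝ (φ (p i)) h := by
  simp [featureSum, sum_inner, inner_smul_left]

lemma kvec_dotProduct (hκ : ∀ x y, κ x y = inner ℝ (φ x) (φ y)) (p : Fin n → 𝒳) (z : 𝒳)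
    (b : Fin n → ℝ) : kvec κ p z ⬝ᵥ b = inner ℝ (φ z) (featureSum φ p b) := by
  simp only [dotProduct, kvec, hκ, inner_featureSum_right]
  exact Finset.sum_congr rfl fun i _ => by rw [real_inner_comm, mul_comm]

lemma obsCov_mulVec (hκ : ∀ x y, κ x y = inner ℝ (φ x) (φ y)) (p : Fin n → 𝒳)
    (b : Fin n → ℝ) (i : Fin n) :
    (obsCov κ ρ p *ᵥ b) i = inner ℝ (φ (p i)) (featureSum φ p b) + ρ (p i) ^ 2 * b i := by
  rw [obsCov, Matrix.add_mulVec, Pi.add_apply, noiseMat, Matrix.mulVec_diagonal]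
  congr 1
  simp only [Matrix.mulVec, dotProduct, gram, Matrix.of_apply, hκ, inner_featureSum_right]
  exact Finset.sum_congr rfl fun i _ => by rw [mul_comm]

lemma obsCov_isSymm (hκ : ∀ x y, κ x y = inner ℝ (φ x) (φ y)) (p : Fin n → 𝒳) :
    (obsCov κ ρ p).IsSymm := by
  refine Matrix.IsSymm.add ?_ (Matrix.isSymm_diagonal _)
  ext i j
  simp [gram, hκ, real_inner_comm]

lemma obsCov_posDef (hκ : ∀ x y, κ x y = inner ℝ (φ x) (φ y)) (hρ : ∀ z, 0 < ρ z)
    (p : Fin n → 𝒳) : (obsCov κ ρ p).PosDef := by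
  refine Matrix.PosDef.of_dotProduct_mulVec_pos ?_ fun b hb => ?_
  · rw [Matrix.IsHermitian, Matrix.conjTranspose_eq_transpose_of_trivial]
    exact obsCov_isSymm hκ p
  · have h : star b ⬝ᵥ (obsCov κ ρ p *ᵥ b)
        = ‖featureSum φ p b‖ ^ 2 + ∑ i, ρ (p i) ^ 2 * b i ^ 2 := by
      rw [← real_inner_self_eq_norm_sq, inner_featureSum_left, ← Finset.sum_add_distrib]
      simp only [dotProduct, obsCov_mulVec hκ, star_trivial]
      exact Finset.sum_congr rfl fun i _ => by ring
    rw [h]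
    obtain ⟨i, hi⟩ := Function.ne_iff.mp hb
    refine add_pos_of_nonneg_of_pos (sq_nonneg _) (Finset.sum_pos' (fun _ _ => by positivity)
      ⟨i, Finset.mem_univ i, ?_⟩)
    have := hρ (p i)
    have : b i ≠ 0 := hi
    positivity

lemma det_obsCov_pos (hκ : ∀ x y, κ x y = inner ℝ (φ x) (φ y)) (hρ : ∀ z, 0 < ρ z)
    (p : Fin n → 𝒳) : 0 < (obsCov κ ρ p).det :=
  (obsCov_posDef hκ hρ p).det_pos

lemma obsCov_mulVec_inv (hκ : ∀ x y, κ x y = inner ℝ (φ x) (φ y)) (hρ : ∀ z, 0 < ρ z)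
    (p : Fin n → 𝒳) (v : Fin n → ℝ) : obsCov κ ρ p *ᵥ ((obsCov κ ρ p)⁻¹ *ᵥ v) = v := by
  rw [Matrix.mulVec_mulVec, Matrix.mul_nonsing_inv _ (det_obsCov_pos hκ hρ p).ne'.isUnit,
    Matrix.one_mulVec]

lemma obsCov_inv_mulVec (hκ : ∀ x y, κ x y = inner ℝ (φ x) (φ y)) (hρ : ∀ z, 0 < ρ z)
    (p : Fin n → 𝒳) (v : Fin n → ℝ) : (obsCov κ ρ p)⁻¹ *ᵥ (obsCov κ ρ p *ᵥ v) = v := by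
  rw [Matrix.mulVec_mulVec, Matrix.nonsing_inv_mul _ (det_obsCov_pos hκ hρ p).ne'.isUnit,
    Matrix.one_mulVec]

lemma dotProduct_obsCov_inv_comm (hκ : ∀ x y, κ x y = inner ℝ (φ x) (φ y)) (p : Fin n → 𝒳)
    (u v : Fin n → ℝ) : u ⬝ᵥ ((obsCov κ ρ p)⁻¹ *ᵥ v) = v ⬝ᵥ ((obsCov κ ρ p)⁻¹ *ᵥ u) := by
  rw [Matrix.dotProduct_mulVec, ← Matrix.mulVec_transpose, Matrix.transpose_nonsing_inv,
    obsCov_isSymm hκ p, dotProduct_comm]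

lemma postMean_one (p : Fin n → 𝒳) (v : Fin n → ℝ) (z : 𝒳) :
    postMean κ ρ 1 p v z = kvec κ p z ⬝ᵥ ((obsCov κ ρ p)⁻¹ *ᵥ v) := by
  simp [postMean, obsCov]

lemma postVar_one (p : Fin n → 𝒳) (z : 𝒳) :
    postVar κ ρ 1 p z = κ z z - kvec κ p z ⬝ᵥ ((obsCov κ ρ p)⁻¹ *ᵥ kvec κ p z) := by
  simp [postVar, obsCov]

/-- The posterior variance is the minimum of the ridge objective
`‖φ(z) - ∑ a_i φ(p_i)‖² + ∑ ρ_i² a_i²`, attained at the kriging weights `a`. -/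
lemma postVar_eq_ridge (hκ : ∀ x y, κ x y = inner ℝ (φ x) (φ y)) (hρ : ∀ z, 0 < ρ z)
    (p : Fin n → 𝒳) (z : 𝒳) :
    postVar κ ρ 1 p z
      = ‖φ z - featureSum φ p ((obsCov κ ρ p)⁻¹ *ᵥ kvec κ p z)‖ ^ 2
        + ∑ i, ρ (p i) ^ 2 * ((obsCov κ ρ p)⁻¹ *ᵥ kvec κ p z) i ^ 2 := by
  rw [postVar_one]
  have ha := obsCov_mulVec_inv hκ hρ p (kvec κ p z)
  set a := (obsCov κ ρ p)⁻¹ *ᵥ kvec κ p z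
  have hi : ∀ i, inner ℝ (φ (p i)) (featureSum φ p a) + ρ (p i) ^ 2 * a i
      = inner ℝ (φ (p i)) (φ z) := fun i => by
    rw [← obsCov_mulVec hκ, ha, kvec, hκ]
  have hs : ∑ i, ρ (p i) ^ 2 * a i ^ 2
      = inner ℝ (featureSum φ p a) (φ z) - inner ℝ (featureSum φ p a) (featureSum φ p a) := by
    rw [inner_featureSum_left, inner_featureSum_left, ← Finset.sum_sub_distrib]
    exact Finset.sum_congr rfl fun i _ => by rw [← hi i]; ring
  rw [hs, kvec_dotProduct hκ, hκ, norm_sub_sq_real, real_inner_self_eq_norm_sq,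
    real_inner_self_eq_norm_sq, real_inner_comm (φ z)]
  ring

lemma postVar_nonneg (hκ : ∀ x y, κ x y = inner ℝ (φ x) (φ y)) (hρ : ∀ z, 0 < ρ z)
    (p : Fin n → 𝒳) (z : 𝒳) : 0 ≤ postVar κ ρ 1 p z := by
  rw [postVar_eq_ridge hκ hρ]
  positivity

lemma postVar_le (hκ : ∀ x y, κ x y = inner ℝ (φ x) (φ y)) (hρ : ∀ z, 0 < ρ z)
    (p : Fin n → 𝒳) (z : 𝒳) : postVar κ ρ 1 p z ≤ κ z z := by
  have h := (obsCov_posDef hκ hρ p).inv.posSemidef.dotProduct_mulVec_nonneg (kvec κ p z)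
  rw [star_trivial] at h
  rw [postVar_one]
  linarith

/-- The self-normalized norm of `η` is the energy `‖h‖² + ∑ h(p_i)² / ρ_i²` of the function
`h = ∑ b_i φ(p_i)`, `b = (K_n + Σ_n)⁻¹ η`, that ridge regression fits to `η`. -/
lemma selfNorm_eq_energy (hκ : ∀ x y, κ x y = inner ℝ (φ x) (φ y)) (hρ : ∀ z, 0 < ρ z)
    (p : Fin n → 𝒳) (η : Fin n → ℝ) :
    selfNorm κ ρ p η
      = ‖featureSum φ p ((obsCov κ ρ p)⁻¹ *ᵥ η)‖ ^ 2
        + ∑ i, inner ℝ (φ (p i)) (featureSum φ p ((obsCov κ ρ p)⁻¹ *ᵥ η)) ^ 2 / ρ (p i) ^ 2 := by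
  rw [selfNorm]
  have hb := obsCov_mulVec_inv hκ hρ p η
  set b := (obsCov κ ρ p)⁻¹ *ᵥ η
  rw [← real_inner_self_eq_norm_sq, inner_featureSum_left, ← Finset.sum_add_distrib, dotProduct,
    ← Finset.sum_sub_distrib]
  refine Finset.sum_congr rfl fun i _ => ?_
  have hi : η i = inner ℝ (φ (p i)) (featureSum φ p b) + ρ (p i) ^ 2 * b i := by
    rw [← obsCov_mulVec hκ, hb]
  have := (hρ (p i)).ne'
  rw [hi]
  field_simp
  ring

lemma selfNorm_nonneg (hκ : ∀ x y, κ x y = inner ℝ (φ x) (φ y)) (hρ : ∀ z, 0 < ρ z)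
    (p : Fin n → 𝒳) (η : Fin n → ℝ) : 0 ≤ selfNorm κ ρ p η := by
  rw [selfNorm_eq_energy hκ hρ]
  positivity

/-- The bias of the posterior mean: in the absence of noise it differs from `f(z)` by at most
`‖f‖ σ_n(z)`. -/
lemma abs_postMean_exact_sub_le (hκ : ∀ x y, κ x y = inner ℝ (φ x) (φ y)) (hρ : ∀ z, 0 < ρ z)
    (p : Fin n → 𝒳) (f : H) (z : 𝒳) :
    |postMean κ ρ 1 p (fun i => inner ℝ (φ (p i)) f) z - inner ℝ (φ z) f|
      ≤ ‖f‖ * postStd κ ρ 1 p z := by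
  have hv := postVar_eq_ridge hκ hρ p z
  rw [postMean_one, dotProduct_obsCov_inv_comm hκ, dotProduct_comm]
  set a := (obsCov κ ρ p)⁻¹ *ᵥ kvec κ p z
  have h : a ⬝ᵥ (fun i => inner ℝ (φ (p i)) f) - inner ℝ (φ z) f
      = -inner ℝ (φ z - featureSum φ p a) f := by
    rw [inner_sub_left, inner_featureSum_left, dotProduct]
    ring
  rw [h, abs_neg, mul_comm]
  refine (abs_real_inner_le_norm _ _).trans ?_
  gcongr
  rw [postStd]
  refine Real.le_sqrt_of_sq_le ?_
  rw [hv]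
  exact le_add_of_nonneg_right (by positivity)

/-- The noise part of the posterior mean is bounded by the self-normalized norm of the noise:
Cauchy-Schwarz in `H × ℝⁿ`, applied to the representations `postVar_eq_ridge` and
`selfNorm_eq_energy`. -/
lemma abs_postMean_noise_le (hκ : ∀ x y, κ x y = inner ℝ (φ x) (φ y)) (hρ : ∀ z, 0 < ρ z)
    (p : Fin n → 𝒳) (η : Fin n → ℝ) (z : 𝒳) :
    |postMean κ ρ 1 p η z| ≤ √(selfNorm κ ρ p η) * postStd κ ρ 1 p z := by
  rw [postStd, ← Real.sqrt_mul (selfNorm_nonneg hκ hρ p η)]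
  refine Real.abs_le_sqrt ?_
  rw [selfNorm_eq_energy hκ hρ, postVar_eq_ridge hκ hρ, postMean_one, kvec_dotProduct hκ]
  set a := (obsCov κ ρ p)⁻¹ *ᵥ kvec κ p z
  set h := featureSum φ p ((obsCov κ ρ p)⁻¹ *ᵥ η)
  set r := φ z - featureSum φ p a with hr
  set S := ∑ i, inner ℝ (φ (p i)) h ^ 2 / ρ (p i) ^ 2
  set W := ∑ i, ρ (p i) ^ 2 * a i ^ 2
  have hS : 0 ≤ S := Finset.sum_nonneg fun _ _ => by positivity
  have hW : 0 ≤ W := Finset.sum_nonneg fun _ _ => by positivity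
  have h1 : inner ℝ (φ z) h = inner ℝ r h + inner ℝ (featureSum φ p a) h := by
    rw [← inner_add_left, hr, sub_add_cancel]
  have h2 : |inner ℝ r h| ≤ ‖r‖ * ‖h‖ := abs_real_inner_le_norm _ _
  have h3 : |inner ℝ (featureSum φ p a) h| ≤ √W * √S := by
    rw [← Real.sqrt_mul hW]
    refine Real.abs_le_sqrt ?_
    have hcs := Finset.sum_mul_sq_le_sq_mul_sq Finset.univ (fun i => ρ (p i) * a i)
      (fun i => inner ℝ (φ (p i)) h / ρ (p i))
    simp only [mul_pow, div_pow] at hcs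
    refine le_of_eq_of_le ?_ hcs
    rw [inner_featureSum_left]
    congr 1
    refine Finset.sum_congr rfl fun i _ => ?_
    have := (hρ (p i)).ne'
    field_simp
  have h4 : |inner ℝ (φ z) h| ≤ ‖r‖ * ‖h‖ + √W * √S := by
    rw [h1]
    exact (abs_add_le _ _).trans (add_le_add h2 h3)
  rw [← sq_abs]
  have h5 := pow_le_pow_left₀ (abs_nonneg _) h4 2
  have h6 := Real.sq_sqrt hS
  have h7 := Real.sq_sqrt hW
  nlinarith [sq_nonneg (‖r‖ * √S - √W * ‖h‖)]

lemma abs_postMean_sub_le (hκ : ∀ x y, κ x y = inner ℝ (φ x) (φ y)) (hρ : ∀ z, 0 < ρ z)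
    (p : Fin n → 𝒳) (f : H) (v η : Fin n → ℝ) (hv : ∀ i, v i = inner ℝ (φ (p i)) f + η i)
    (z : 𝒳) :
    |postMean κ ρ 1 p v z - inner ℝ (φ z) f|
      ≤ (√(selfNorm κ ρ p η) + ‖f‖) * postStd κ ρ 1 p z := by
  have hs : v = (fun i => inner ℝ (φ (p i)) f) + η := funext hv
  have h : postMean κ ρ 1 p v z - inner ℝ (φ z) f
      = (postMean κ ρ 1 p (fun i => inner ℝ (φ (p i)) f) z - inner ℝ (φ z) f)
        + postMean κ ρ 1 p η z := by
    simp only [postMean_one, hs, Matrix.mulVec_add, dotProduct_add]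
    ring
  rw [h, add_mul, add_comm (√_ * _)]
  exact (abs_add_le _ _).trans (add_le_add (abs_postMean_exact_sub_le hκ hρ p f z)
    (abs_postMean_noise_le hκ hρ p η z))

/-! ### Recursions in the number of observations -/

lemma det_noiseMat_pos (hρ : ∀ z, 0 < ρ z) (p : Fin n → 𝒳) : 0 < (noiseMat ρ p).det := by
  rw [noiseMat, Matrix.det_diagonal]
  exact Finset.prod_pos fun i _ => pow_pos (hρ _) 2

lemma det_noiseMat_succ (p : Fin (n + 1) → 𝒳) :
    (noiseMat ρ p).det
      = (noiseMat ρ fun i : Fin n => p i.castSucc).det * ρ (p (Fin.last n)) ^ 2 := by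
  simp [noiseMat, Matrix.det_diagonal, Fin.prod_univ_castSucc]

/-- The Schur complement of the first `n` observations is the predictive variance of the last. -/
lemma det_obsCov_succ (hκ : ∀ x y, κ x y = inner ℝ (φ x) (φ y)) (hρ : ∀ z, 0 < ρ z)
    (p : Fin (n + 1) → 𝒳) :
    (obsCov κ ρ p).det = (obsCov κ ρ fun i : Fin n => p i.castSucc).det
      * (ρ (p (Fin.last n)) ^ 2
        + postVar κ ρ 1 (fun i : Fin n => p i.castSucc) (p (Fin.last n))) := by
  set q : Fin n → 𝒳 := fun i => p i.castSucc with hq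
  set z := p (Fin.last n) with hz
  have hblock : (obsCov κ ρ p).submatrix finSumFinEquiv finSumFinEquiv
      = Matrix.fromBlocks (obsCov κ ρ q) (Matrix.of fun i (_ : Fin 1) => kvec κ q z i)
        (Matrix.of fun (_ : Fin 1) i => kvec κ q z i)
        (Matrix.of fun _ _ => κ z z + ρ z ^ 2) := by
    have hlast : Fin.natAdd n (0 : Fin 1) = Fin.last n := rfl
    ext i j
    rcases i with i | i <;> rcases j with j | j
    · have hc : ∀ k : Fin n, Fin.castAdd 1 k = k.castSucc := fun _ => rfl
      by_cases hij : i = j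
      · subst hij; simp [obsCov, gram, noiseMat, hq, hc]
      · simp [obsCov, gram, noiseMat, hq, hij, hc]
    · have hc : Fin.castAdd 1 i = i.castSucc := rfl
      have hne : Fin.castSucc i ≠ Fin.last n := Fin.castSucc_ne_last i
      simp [obsCov, gram, noiseMat, kvec, hq, hz, hc, Subsingleton.elim j 0, hlast, hne]
    · have hc : Fin.castAdd 1 j = j.castSucc := rfl
      have hne : Fin.last n ≠ Fin.castSucc j := (Fin.castSucc_ne_last j).symm
      simp [obsCov, gram, noiseMat, kvec, hq, hz, hc, Subsingleton.elim i 0, hlast, hne,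
        hκ, real_inner_comm]
    · simp [obsCov, gram, noiseMat, hz, Subsingleton.elim i 0, Subsingleton.elim j 0, hlast]
  have hA := det_obsCov_pos hκ hρ q
  let := Matrix.invertibleOfIsUnitDet _ hA.ne'.isUnit
  rw [← Matrix.det_submatrix_equiv_self finSumFinEquiv, hblock, Matrix.det_fromBlocks₁₁,
    Matrix.det_fin_one, postVar_one, Matrix.invOf_eq_nonsing_inv, Matrix.mul_assoc]
  congr 1
  simp only [Matrix.sub_apply, Matrix.of_apply, Matrix.mul_apply, dotProduct, Matrix.mulVec]
  ring

/-- A new observation adds to the quadratic form of the precision matrix the square of its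
standardized innovation. -/
lemma dotProduct_obsCov_inv_succ (hκ : ∀ x y, κ x y = inner ℝ (φ x) (φ y)) (hρ : ∀ z, 0 < ρ z)
    (p : Fin (n + 1) → 𝒳) (η : Fin (n + 1) → ℝ) :
    η ⬝ᵥ ((obsCov κ ρ p)⁻¹ *ᵥ η)
      = (fun i : Fin n => η i.castSucc)
          ⬝ᵥ ((obsCov κ ρ fun i : Fin n => p i.castSucc)⁻¹ *ᵥ fun i : Fin n => η i.castSucc)
        + (η (Fin.last n) - postMean κ ρ 1 (fun i : Fin n => p i.castSucc)
            (fun i => η i.castSucc) (p (Fin.last n))) ^ 2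
          / (ρ (p (Fin.last n)) ^ 2
            + postVar κ ρ 1 (fun i : Fin n => p i.castSucc) (p (Fin.last n))) := by
  set q : Fin n → 𝒳 := fun i => p i.castSucc with hq
  set z := p (Fin.last n) with hz
  set e : Fin n → ℝ := fun i => η i.castSucc with he
  have hpos : 0 < ρ z ^ 2 + postVar κ ρ 1 q z :=
    add_pos_of_pos_of_nonneg (pow_pos (hρ z) 2) (postVar_nonneg hκ hρ q z)
  have hb := obsCov_mulVec_inv hκ hρ q e
  have ha := obsCov_mulVec_inv hκ hρ q (kvec κ q z)
  have hcomm : e ⬝ᵥ ((obsCov κ ρ q)⁻¹ *ᵥ kvec κ q z) = postMean κ ρ 1 q e z := by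
    rw [postMean_one, dotProduct_obsCov_inv_comm hκ]
  set s := ρ z ^ 2 + postVar κ ρ 1 q z with hs
  set m := postMean κ ρ 1 q e z with hm
  have hv := postVar_one (κ := κ) (ρ := ρ) q z
  rw [postMean_one] at hm
  set b := (obsCov κ ρ q)⁻¹ *ᵥ e with hbdef
  set a := (obsCov κ ρ q)⁻¹ *ᵥ kvec κ q z
  set c := (η (Fin.last n) - m) / s with hc
  have hcs : c * s = η (Fin.last n) - m := div_mul_cancel₀ _ hpos.ne'
  -- Block elimination: the solution of the enlarged system, written through the old solutions.
  let w : Fin (n + 1) → ℝ := Fin.snoc (fun i => b i - c * a i) c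
  have hfs : featureSum φ p w = featureSum φ q b - c • featureSum φ q a + c • φ z := by
    simp only [featureSum, Fin.sum_univ_castSucc, w, Fin.snoc_castSucc, Fin.snoc_last, sub_smul,
      Finset.sum_sub_distrib, Finset.smul_sum, mul_smul, hq, hz]
  have hw : obsCov κ ρ p *ᵥ w = η := by
    funext i
    rw [obsCov_mulVec hκ, hfs]
    refine Fin.lastCases ?_ (fun i => ?_) i
    · have h1 : w (Fin.last n) = c := Fin.snoc_last _ _
      rw [kvec_dotProduct hκ] at hv hm
      rw [h1, inner_add_right, inner_sub_right, inner_smul_right, inner_smul_right, ← hz, ← hκ,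
        ← hm]
      rw [hs, hv] at hcs
      linarith
    · have h1 : w i.castSucc = b i - c * a i := Fin.snoc_castSucc ..
      have h2 := congrFun hb i
      have h3 := congrFun ha i
      rw [obsCov_mulVec hκ] at h2 h3
      rw [h1, inner_add_right, inner_sub_right, inner_smul_right, inner_smul_right,
        ← hκ _ z]
      change _ = e i
      change _ = κ (q i) z at h3
      rw [← h2]
      change inner ℝ (φ (q i)) _ - c * inner ℝ (φ (q i)) _ + c * κ (q i) z
        + ρ (q i) ^ 2 * (b i - c * a i) = _
      rw [← h3]
      ring
  have hinv : (obsCov κ ρ p)⁻¹ *ᵥ η = w := by rw [← hw, obsCov_inv_mulVec hκ hρ]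
  have hdot : η ⬝ᵥ w = e ⬝ᵥ b - c * (e ⬝ᵥ a) + η (Fin.last n) * c := by
    simp only [dotProduct, Fin.sum_univ_castSucc, w, Fin.snoc_castSucc, Fin.snoc_last,
      Finset.mul_sum, ← Finset.sum_sub_distrib, he]
    congr 1
    exact Finset.sum_congr rfl fun i _ => by ring
  rw [hinv, hdot, hcomm, hc]
  ring

lemma selfNorm_succ (hκ : ∀ x y, κ x y = inner ℝ (φ x) (φ y)) (hρ : ∀ z, 0 < ρ z)
    (p : Fin (n + 1) → 𝒳) (η : Fin (n + 1) → ℝ) :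
    selfNorm κ ρ p η
      = selfNorm κ ρ (fun i : Fin n => p i.castSucc) (fun i => η i.castSucc)
        + (η (Fin.last n) ^ 2 / ρ (p (Fin.last n)) ^ 2
        - (η (Fin.last n) - postMean κ ρ 1 (fun i : Fin n => p i.castSucc)
            (fun i => η i.castSucc) (p (Fin.last n))) ^ 2
          / (ρ (p (Fin.last n)) ^ 2
            + postVar κ ρ 1 (fun i : Fin n => p i.castSucc) (p (Fin.last n)))) := by
  rw [selfNorm, selfNorm, dotProduct_obsCov_inv_succ hκ hρ, Fin.sum_univ_castSucc]
  ring

end LinearAlgebra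

/-! ### The Gaussian mixture of exponential martingale increments -/

section Mixture

/-- The ratio at `u` of the densities of the normal laws `N(m, R + V)` and `N(0, R)`. -/
noncomputable def mixtureFactor (R V m u : ℝ) : ℝ :=
  √(R / (R + V)) * Real.exp ((u ^ 2 / R - (u - m) ^ 2 / (R + V)) / 2)

/-- The density ratio is a mixture of the exponential weights `exp(θ u - θ² R / 2)`, where `θ`
is normal with mean `m / R` and variance `V / R²`. Writing `θ` as an affine image of a standard
normal variable includes the degenerate case `V = 0`. -/
lemma lintegral_gaussian_mixture {R V : ℝ} (hR : 0 < R) (hV : 0 ≤ V) (m u : ℝ) :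
    ∫⁻ g, ENNReal.ofReal (Real.exp ((m + √V * g) / R * u - R * ((m + √V * g) / R) ^ 2 / 2))
        ∂(gaussianReal 0 1)
      = ENNReal.ofReal (mixtureFactor R V m u) := by
  have hRV : 0 < R + V := by linarith
  set a := (R + V) / (2 * R) with ha
  have ha0 : 0 < a := by positivity
  set g₀ := √V * (u - m) / (R + V) with hg₀
  set c := (u ^ 2 / R - (u - m) ^ 2 / (R + V)) / 2 with hc
  have hsq : √V ^ 2 = V := Real.sq_sqrt hV
  rw [gaussianReal_of_var_ne_zero 0 one_ne_zero,
    lintegral_withDensity_eq_lintegral_mul _ (measurable_gaussianPDF 0 1) (by fun_prop)]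
  have hint : Integrable fun g : ℝ => Real.exp (-a * (g - g₀) ^ 2) :=
    (integrable_exp_neg_mul_sq ha0).comp_sub_right g₀
  have hval : ∀ g : ℝ, (gaussianPDF 0 1 * fun g => ENNReal.ofReal
        (Real.exp ((m + √V * g) / R * u - R * ((m + √V * g) / R) ^ 2 / 2))) g
      = ENNReal.ofReal ((√(2 * Real.pi))⁻¹ * Real.exp c * Real.exp (-a * (g - g₀) ^ 2)) := by
    intro g
    rw [Pi.mul_apply, gaussianPDF, ← ENNReal.ofReal_mul (gaussianPDFReal_nonneg _ _ _),
      gaussianPDFReal]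
    simp only [NNReal.coe_one, mul_one, sub_zero]
    rw [mul_assoc, mul_assoc, ← Real.exp_add, ← Real.exp_add]
    congr 3
    rw [ha, hg₀, hc]
    generalize √V = s at hsq
    subst hsq
    field_simp
    ring
  simp_rw [hval]
  rw [← ofReal_integral_eq_lintegral_ofReal (hint.const_mul _)
    (Filter.Eventually.of_forall fun g => by positivity), integral_const_mul,
    integral_sub_right_eq_self (fun g => Real.exp (-a * g ^ 2)) g₀, integral_gaussian]
  congr 1
  rw [mixtureFactor, mul_right_comm, ← hc]
  congr 1
  rw [inv_mul_eq_div, ← Real.sqrt_div' _ (by positivity)]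
  congr 1
  rw [ha]
  have := Real.pi_pos.ne'
  field_simp

variable {Ω : Type*} [MeasurableSpace Ω] {P : Measure Ω}

/-- By Tonelli's theorem, since every exponential weight has mean at most one. -/
lemma lintegral_mixtureFactor_le_one [IsProbabilityMeasure P] {R V : ℝ} (hR : 0 < R) (hV : 0 ≤ V)
    (m : ℝ) {Z : Ω → ℝ} (hZ : Measurable Z) (hsub : HasSubgaussianMGF Z R.toNNReal P) :
    ∫⁻ ω, ENNReal.ofReal (mixtureFactor R V m (Z ω)) ∂P ≤ 1 := by
  simp_rw [← lintegral_gaussian_mixture hR hV]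
  rw [lintegral_lintegral_swap (by fun_prop)]
  calc _ ≤ ∫⁻ _ : ℝ, 1 ∂(gaussianReal 0 1) := lintegral_mono fun g => ?_
    _ = 1 := by simp
  set θ := (m + √V * g) / R
  have hle := hsub.mgf_le θ
  rw [Real.coe_toNNReal R hR.le, mgf] at hle
  have hsplit : ∀ ω, Real.exp (θ * Z ω - R * θ ^ 2 / 2)
      = Real.exp (-(R * θ ^ 2 / 2)) * Real.exp (θ * Z ω) := fun ω => by
    rw [← Real.exp_add]; ring_nf
  simp_rw [hsplit]
  rw [← ofReal_integral_eq_lintegral_ofReal ((hsub.integrable_exp_mul θ).const_mul _)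
    (Filter.Eventually.of_forall fun ω => by positivity), integral_const_mul]
  refine ENNReal.ofReal_le_one.2 ?_
  calc _ ≤ Real.exp (-(R * θ ^ 2 / 2)) * Real.exp (R * θ ^ 2 / 2) := by gcongr
    _ = 1 := by rw [← Real.exp_add]; simp

end Mixture

/-! ### Independence and Ville's inequality -/

section Probability

variable {Ω : Type*} {mΩ : MeasurableSpace Ω} {P : Measure Ω}

lemma lintegral_comp_indepFun {α β : Type*} [MeasurableSpace α] [MeasurableSpace β]
    [IsProbabilityMeasure P] {X : Ω → α} {Y : Ω → β} (hX : Measurable X) (hY : Measurable Y)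
    (hXY : IndepFun X Y P) {F : α × β → ℝ≥0∞} (hF : Measurable F) :
    ∫⁻ ω, F (X ω, Y ω) ∂P = ∫⁻ ω, ∫⁻ ω', F (X ω, Y ω') ∂P ∂P := by
  rw [← lintegral_map (f := F) hF (hX.prodMk hY),
    (indepFun_iff_map_prod_eq_prod_map_map hX.aemeasurable hY.aemeasurable).1 hXY,
    lintegral_prod _ hF.aemeasurable]
  rw [lintegral_map hF.lintegral_prod_right' hX]
  exact lintegral_congr fun ω => lintegral_map (hF.comp measurable_prodMk_left) hY

/-- Given one of two independent σ-algebras, the other one can be integrated out. -/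
lemma lintegral_diag_of_indep [IsProbabilityMeasure P] {m₁ m₂ : MeasurableSpace Ω} (h₁ : m₁ ≤ mΩ)
    (h₂ : m₂ ≤ mΩ) (hind : Indep m₁ m₂ P) {F : Ω × Ω → ℝ≥0∞}
    (hF : Measurable[m₁.prod m₂] F) :
    ∫⁻ ω, F (ω, ω) ∂P = ∫⁻ ω, ∫⁻ ω', F (ω, ω') ∂P ∂P := by
  refine @lintegral_comp_indepFun Ω mΩ P Ω Ω m₁ m₂ _ id id (measurable_id'' h₁)
    (measurable_id'' h₂) ?_ F hF
  change Indep (m₁.comap id) (m₂.comap id) P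
  rwa [MeasurableSpace.comap_id, MeasurableSpace.comap_id]

/-- **Ville's inequality** for a nonnegative supermartingale, formulated with lower integrals. -/
lemma mul_measure_exists_gt_le {ℱ : Filtration ℕ mΩ} {M : ℕ → Ω → ℝ≥0∞}
    (hM : ∀ n, Measurable[ℱ n] (M n))
    (hsup : ∀ n, ∀ B, MeasurableSet[ℱ n] B → ∫⁻ ω in B, M (n + 1) ω ∂P ≤ ∫⁻ ω in B, M n ω ∂P)
    (c : ℝ≥0∞) : c * P {ω | ∃ n, c < M n ω} ≤ ∫⁻ ω, M 0 ω ∂P := by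
  let A : ℕ → Set Ω := fun n => {ω | ∃ k ≤ n, c < M k ω}
  have hAm : ∀ n, MeasurableSet[ℱ n] (A n) := fun n => by
    have : A n = ⋃ k ∈ Set.Iic n, {ω | c < M k ω} := by ext; simp [A]
    rw [this]
    refine MeasurableSet.biUnion (Set.to_countable _) fun k hk => ?_
    exact ((hM k).mono (ℱ.mono hk) le_rfl) measurableSet_Ioi
  have hAmono : Monotone A := fun i j hij ω ⟨k, hk, h⟩ => ⟨k, hk.trans hij, h⟩
  -- The integral of the supermartingale stopped when it first exceeds `c` does not increase.
  have hbound : ∀ n, c * P (A n) + ∫⁻ ω in (A n)ᶜ, M n ω ∂P ≤ ∫⁻ ω, M 0 ω ∂P := by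
    intro n
    induction n with
    | zero =>
      have h0 : MeasurableSet (A 0) := ℱ.le 0 _ (hAm 0)
      rw [← lintegral_add_compl (μ := P) (M 0) h0]
      refine add_le_add ?_ le_rfl
      rw [← setLIntegral_const]
      refine setLIntegral_mono' h0 fun ω ⟨k, hk, h⟩ => ?_
      rw [Nat.le_zero.1 hk] at h
      exact h.le
    | succ n ih =>
      have h0 : MeasurableSet (A n) := ℱ.le n _ (hAm n)
      have h1 : MeasurableSet (A (n + 1)) := ℱ.le (n + 1) _ (hAm (n + 1))
      have hsub : A n ⊆ A (n + 1) := hAmono n.le_succ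
      refine le_trans ?_ ih
      have hP : P (A (n + 1)) = P (A n) + P (A (n + 1) \ A n) := by
        rw [← measure_union Set.disjoint_sdiff_right (h1.diff h0), Set.union_sdiff_cancel hsub]
      have hI : ∫⁻ ω in (A n)ᶜ, M (n + 1) ω ∂P
          = ∫⁻ ω in A (n + 1) \ A n, M (n + 1) ω ∂P + ∫⁻ ω in (A (n + 1))ᶜ, M (n + 1) ω ∂P := by
        rw [← lintegral_union h1.compl]
        · congr 2
          ext ω
          have := @hsub ω
          simp only [Set.mem_compl_iff, Set.mem_union, Set.mem_sdiff]
          tauto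
        · exact Set.disjoint_left.2 fun ω hω hω' => hω' hω.1
      have hc : c * P (A (n + 1) \ A n) ≤ ∫⁻ ω in A (n + 1) \ A n, M (n + 1) ω ∂P := by
        rw [← setLIntegral_const]
        refine setLIntegral_mono' (h1.diff h0) fun ω ⟨⟨k, hk, h⟩, hn⟩ => ?_
        rcases Nat.lt_or_ge n k with hlt | hge
        · rw [le_antisymm hk hlt] at h
          exact h.le
        · exact absurd ⟨k, hge, h⟩ hn
      calc _ = c * P (A n) + (c * P (A (n + 1) \ A n)
            + ∫⁻ ω in (A (n + 1))ᶜ, M (n + 1) ω ∂P) := by rw [hP, mul_add, add_assoc]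
        _ ≤ c * P (A n) + ∫⁻ ω in (A n)ᶜ, M (n + 1) ω ∂P := by rw [hI]; gcongr
        _ ≤ _ := add_le_add_right (hsup n _ (hAm n).compl) _
  have hU : {ω | ∃ n, c < M n ω} = ⋃ n, A n := by
    ext ω
    simp only [Set.mem_ofPred_eq, Set.mem_iUnion, A]
    exact ⟨fun ⟨n, h⟩ => ⟨n, n, le_rfl, h⟩, fun ⟨_, k, _, h⟩ => ⟨k, h⟩⟩
  rw [hU, hAmono.measure_iUnion, ENNReal.mul_iSup]
  exact iSup_le fun n => le_self_add.trans (hbound n)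

end Probability

/-! ### Measurability of the posterior -/

section Measurability

variable {α 𝒳 : Type*} [MeasurableSpace 𝒳] {m : MeasurableSpace α} {n : ℕ}
  {κ : 𝒳 → 𝒳 → ℝ} {ρ : 𝒳 → ℝ} {p : α → Fin n → 𝒳} {v : α → Fin n → ℝ} {z : α → 𝒳}

lemma measurable_det {A : α → Matrix (Fin n) (Fin n) ℝ} (hA : ∀ i j, Measurable fun a => A a i j) :
    Measurable fun a => (A a).det := by
  simp only [Matrix.det_apply']
  fun_prop

lemma measurable_inv_entry {A : α → Matrix (Fin n) (Fin n) ℝ}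
    (hA : ∀ i j, Measurable fun a => A a i j) (i j : Fin n) :
    Measurable fun a => (A a)⁻¹ i j := by
  simp only [Matrix.inv_def, Matrix.smul_apply, smul_eq_mul, Ring.inverse_eq_inv',
    Matrix.adjugate_apply]
  refine (measurable_det hA).inv.mul (measurable_det fun k l => ?_)
  by_cases h : k = j
  · simp [h]
  · simpa [Matrix.updateRow_ne h] using hA k l

lemma measurable_obsCov_entry (hκ : Measurable fun q : 𝒳 × 𝒳 => κ q.1 q.2) (hρ : Measurable ρ)
    (hp : ∀ i, Measurable fun a => p a i) (i j : Fin n) :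
    Measurable fun a => obsCov κ ρ (p a) i j := by
  simp only [obsCov, gram, noiseMat, Matrix.add_apply, Matrix.of_apply, Matrix.diagonal_apply]
  refine (hκ.comp ((hp i).prodMk (hp j))).add ?_
  split_ifs
  · exact (hρ.comp (hp i)).pow_const 2
  · exact measurable_const

lemma measurable_dotProduct_inv_mulVec {A : α → Matrix (Fin n) (Fin n) ℝ} {u v : α → Fin n → ℝ}
    (hu : ∀ i, Measurable fun a => u a i) (hA : ∀ i j, Measurable fun a => A a i j)
    (hv : ∀ i, Measurable fun a => v a i) :
    Measurable fun a => u a ⬝ᵥ ((A a)⁻¹ *ᵥ v a) := by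
  have h : ∀ i, Measurable fun a => ((A a)⁻¹ *ᵥ v a) i := fun i =>
    Finset.measurable_fun_sum Finset.univ fun j _ => (measurable_inv_entry hA i j).fun_mul (hv j)
  exact Finset.measurable_fun_sum Finset.univ fun i _ => (hu i).fun_mul (h i)

lemma measurable_postMean (hκ : Measurable fun q : 𝒳 × 𝒳 => κ q.1 q.2) (hρ : Measurable ρ)
    (hp : ∀ i, Measurable fun a => p a i) (hv : ∀ i, Measurable fun a => v a i)
    (hz : Measurable z) : Measurable fun a => postMean κ ρ 1 (p a) (v a) (z a) := by
  simp only [postMean_one]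
  exact measurable_dotProduct_inv_mulVec (fun i => hκ.comp ((hp i).prodMk hz))
    (measurable_obsCov_entry hκ hρ hp) hv

lemma measurable_postVar (hκ : Measurable fun q : 𝒳 × 𝒳 => κ q.1 q.2) (hρ : Measurable ρ)
    (hp : ∀ i, Measurable fun a => p a i)
    (hz : Measurable z) : Measurable fun a => postVar κ ρ 1 (p a) (z a) := by
  simp only [postVar_one]
  exact (hκ.comp (hz.prodMk hz)).sub <|
    measurable_dotProduct_inv_mulVec (fun i => hκ.comp ((hp i).prodMk hz))
      (measurable_obsCov_entry hκ hρ hp) fun i => hκ.comp ((hp i).prodMk hz)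

lemma measurable_selfNorm (hκ : Measurable fun q : 𝒳 × 𝒳 => κ q.1 q.2) (hρ : Measurable ρ)
    (hp : ∀ i, Measurable fun a => p a i) (hv : ∀ i, Measurable fun a => v a i) :
    Measurable fun a => selfNorm κ ρ (p a) (v a) := by
  simp only [selfNorm]
  exact (Finset.measurable_fun_sum _ fun i _ =>
    ((hv i).pow_const 2).div ((hρ.comp (hp i)).pow_const 2)).sub <|
      measurable_dotProduct_inv_mulVec hv (measurable_obsCov_entry hκ hρ hp) hv

/-- A reproducing kernel Hilbert space with measurable kernel consists of measurable functions:
they are pointwise limits of linear combinations of kernel sections. -/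
lemma measurable_rkhs {H : Type*} [NormedAddCommGroup H] [InnerProductSpace ℝ H] [CompleteSpace H]
    [RKHS ℝ H 𝒳 ℝ] (hκ : Measurable fun q : 𝒳 × 𝒳 => scalarKernel H q.1 q.2) (f : H) :
    Measurable f := by
  have hspan : ∀ g ∈ Submodule.span ℝ {RKHS.kerFun H x v | (x : 𝒳) (v : ℝ)},
      Measurable (g : 𝒳 → ℝ) := by
    intro g hg
    induction hg using Submodule.span_induction with
    | mem g hg =>
      obtain ⟨x, v, rfl⟩ := hg
      have : (RKHS.kerFun H x v : 𝒳 → ℝ) = fun z => v * scalarKernel H z x := by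
        funext z
        rw [RKHS.kerFun_apply, scalarKernel, ← smul_eq_mul, ← map_smul, smul_eq_mul, mul_one]
      rw [this]
      exact (hκ.comp measurable_prodMk_right).const_mul v
    | zero => rw [RKHS.coe_zero]; exact measurable_zero
    | add g h _ _ hg hh => rw [RKHS.coe_add]; exact hg.add hh
    | smul c g _ hg => rw [RKHS.coe_smul]; exact hg.const_smul c
  have hf : f ∈ (Submodule.span ℝ {RKHS.kerFun H x v | (x : 𝒳) (v : ℝ)}).topologicalClosure := by
    rw [RKHS.kerFun_dense]; trivial
  obtain ⟨g, hg, hlim⟩ := mem_closure_iff_seq_limit.1 hf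
  refine measurable_of_tendsto_metrizable (fun n => hspan (g n) (hg n)) ?_
  exact tendsto_pi_nhds.2 fun x => ((RKHS.continuous_eval x).tendsto f).comp hlim

end Measurability

/-! ### The mixture supermartingale and the confidence widths -/

section Confidence

section Deterministic

variable {𝒳 H : Type*} [NormedAddCommGroup H] [InnerProductSpace ℝ H]
  {κ : 𝒳 → 𝒳 → ℝ} {φ : 𝒳 → H} {ρ : 𝒳 → ℝ} {n : ℕ}

/-- The nonnegative supermartingale of the method of mixtures, as a function of the points and of
the noise: the square root of `det Σ_n / det (K_n + Σ_n)` times the exponential of half the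
self-normalized norm. -/
noncomputable def mixtureValue (κ : 𝒳 → 𝒳 → ℝ) (ρ : 𝒳 → ℝ) {n : ℕ} (p : Fin n → 𝒳)
    (η : Fin n → ℝ) : ℝ :=
  √((noiseMat ρ p).det / (obsCov κ ρ p).det) * Real.exp (selfNorm κ ρ p η / 2)

lemma mixtureValue_zero (p : Fin 0 → 𝒳) (η : Fin 0 → ℝ) : mixtureValue κ ρ p η = 1 := by
  simp [mixtureValue, selfNorm]

lemma mixtureValue_nonneg (p : Fin n → 𝒳) (η : Fin n → ℝ) : 0 ≤ mixtureValue κ ρ p η := by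
  unfold mixtureValue
  positivity

lemma mixtureValue_succ (hκ : ∀ x y, κ x y = inner ℝ (φ x) (φ y)) (hρ : ∀ z, 0 < ρ z)
    (p : Fin (n + 1) → 𝒳) (η : Fin (n + 1) → ℝ) :
    mixtureValue κ ρ p η
      = mixtureValue κ ρ (fun i : Fin n => p i.castSucc) (fun i => η i.castSucc)
        * mixtureFactor (ρ (p (Fin.last n)) ^ 2)
          (postVar κ ρ 1 (fun i : Fin n => p i.castSucc) (p (Fin.last n)))
          (postMean κ ρ 1 (fun i : Fin n => p i.castSucc) (fun i => η i.castSucc)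
            (p (Fin.last n)))
          (η (Fin.last n)) := by
  have h₁ := det_noiseMat_pos hρ fun i : Fin n => p i.castSucc
  have h₂ := det_obsCov_pos hκ hρ fun i : Fin n => p i.castSucc
  rw [mixtureValue, mixtureValue, mixtureFactor, det_noiseMat_succ, det_obsCov_succ hκ hρ,
    selfNorm_succ hκ hρ, add_div (selfNorm κ ρ _ _), Real.exp_add, mul_div_mul_comm,
    Real.sqrt_mul (by positivity)]
  ring

lemma confWidth_one (b δ : ℝ) (p : Fin n → 𝒳) :
    confWidth κ ρ 1 b δ p
      = √(2 * Real.log (√((obsCov κ ρ p).det) / (δ * √((noiseMat ρ p).det)))) + b := by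
  simp [confWidth, obsCov, add_comm]

lemma sqrt_selfNorm_add_le_confWidth (hκ : ∀ x y, κ x y = inner ℝ (φ x) (φ y))
    (hρ : ∀ z, 0 < ρ z) {δ : ℝ} (hδ : 0 < δ) (b : ℝ) (p : Fin n → 𝒳) (η : Fin n → ℝ)
    (h : mixtureValue κ ρ p η ≤ 1 / δ) :
    √(selfNorm κ ρ p η) + b ≤ confWidth κ ρ 1 b δ p := by
  have h₁ := Real.sqrt_pos.2 (det_noiseMat_pos hρ p)
  have h₂ := Real.sqrt_pos.2 (det_obsCov_pos hκ hρ p)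
  rw [confWidth_one]
  gcongr
  rw [← div_le_iff₀' two_pos]
  refine (Real.le_log_iff_exp_le (by positivity)).2 ?_
  rw [mixtureValue, Real.sqrt_div (det_noiseMat_pos hρ p).le] at h
  rw [le_div_iff₀ (by positivity)]
  rw [le_div_iff₀ hδ, div_mul_eq_mul_div, div_mul_eq_mul_div, div_le_one h₂] at h
  linarith

lemma confWidth_le_succ (hκ : ∀ x y, κ x y = inner ℝ (φ x) (φ y)) (hρ : ∀ z, 0 < ρ z)
    {δ : ℝ} (hδ : 0 < δ) (b : ℝ) (p : Fin (n + 1) → 𝒳) :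
    confWidth κ ρ 1 b δ (fun i : Fin n => p i.castSucc) ≤ confWidth κ ρ 1 b δ p := by
  have h₁ := det_noiseMat_pos hρ fun i : Fin n => p i.castSucc
  have h₂ := det_obsCov_pos hκ hρ fun i : Fin n => p i.castSucc
  have h₃ := hρ (p (Fin.last n))
  have h₄ := postVar_nonneg hκ hρ (fun i : Fin n => p i.castSucc) (p (Fin.last n))
  rw [confWidth_one, confWidth_one, det_noiseMat_succ, det_obsCov_succ hκ hρ,
    Real.sqrt_mul h₁.le, Real.sqrt_mul h₂.le, ← mul_assoc, mul_div_mul_comm]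
  gcongr
  refine le_mul_of_one_le_right (by positivity) ?_
  rw [one_le_div (by positivity)]
  exact Real.sqrt_le_sqrt (by linarith)

end Deterministic

variable {𝒳 Ω H : Type*} [MeasurableSpace 𝒳] [NormedAddCommGroup H] [InnerProductSpace ℝ H]
  {κ : 𝒳 → 𝒳 → ℝ} {φ : 𝒳 → H} {f ρ : 𝒳 → ℝ} {n : ℕ}
  {mΩ : MeasurableSpace Ω} {P : Measure Ω}
  {ℱ : Filtration ℕ mΩ} {𝒩 : ℕ → MeasurableSpace Ω}
  {ξ : ℕ → 𝒳 → Ω → ℝ} {x : ℕ → Ω → 𝒳} {y : ℕ → Ω → ℝ}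

/-- The noise `ξ_t(x_t)` of the observation of round `t`. -/
def obsNoise (ξ : ℕ → 𝒳 → Ω → ℝ) (x : ℕ → Ω → 𝒳) (t : ℕ) (ω : Ω) : ℝ :=
  ξ t (x t ω) ω

lemma IsSampling.measurable_firstTerms_point (h : IsSampling P f ρ ℱ 𝒩 ξ x y) (i : Fin n) :
    Measurable[ℱ n] fun ω => firstTerms x n ω i :=
  (h.point_measurable i).mono (ℱ.mono i.isLt.le) le_rfl

/-- The learner can recover the noise of the past rounds, because `f` is not random. -/
lemma IsSampling.measurable_firstTerms_noise (h : IsSampling P f ρ ℱ 𝒩 ξ x y)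
    (hf : Measurable f) (i : Fin n) :
    Measurable[ℱ n] fun ω => firstTerms (obsNoise ξ x) n ω i := by
  have heq : (fun ω => firstTerms (obsNoise ξ x) n ω i)
      = fun ω => y (i + 1) ω - f (x (i + 1) ω) := by
    funext ω
    simp [firstTerms, obsNoise, h.obs_eq]
  rw [heq]
  exact ((h.obs_measurable i).mono (ℱ.mono i.isLt) le_rfl).fun_sub
    (hf.comp (h.measurable_firstTerms_point i))

lemma IsSampling.measurable_mixtureValue (h : IsSampling P f ρ ℱ 𝒩 ξ x y)
    (hf : Measurable f) (hκm : Measurable fun q : 𝒳 × 𝒳 => κ q.1 q.2) (hρm : Measurable ρ)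
    (n : ℕ) :
    Measurable[ℱ n] fun ω => mixtureValue κ ρ (firstTerms x n ω)
      (firstTerms (obsNoise ξ x) n ω) := by
  have hp := fun i => h.measurable_firstTerms_point (n := n) i
  have h₁ : Measurable[ℱ n] fun ω => (obsCov κ ρ (firstTerms x n ω)).det :=
    measurable_det (measurable_obsCov_entry hκm hρm hp)
  have h₂ : Measurable[ℱ n] fun ω => (noiseMat ρ (firstTerms x n ω)).det := by
    simp only [noiseMat, Matrix.det_diagonal]
    exact Finset.measurable_fun_prod _ fun i _ => (hρm.comp (hp i)).pow_const 2
  have h₃ : Measurable[ℱ n] fun ω => selfNorm κ ρ (firstTerms x n ω)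
      (firstTerms (obsNoise ξ x) n ω) :=
    measurable_selfNorm hκm hρm hp fun i => h.measurable_firstTerms_noise hf i
  exact (Real.continuous_sqrt.measurable.comp (h₂.div h₁)).mul
    (Real.measurable_exp.comp (h₃.div_const 2))

lemma measurable_mul_mixtureFactor {α β : Type*} [MeasurableSpace α] [MeasurableSpace β]
    {a : α → ℝ≥0∞} {R V m : α → ℝ} {x : α → 𝒳} {ξ : 𝒳 → β → ℝ} (ha : Measurable a)
    (hR : Measurable R) (hV : Measurable V) (hm : Measurable m) (hx : Measurable x)
    (hξ : Measurable fun q : 𝒳 × β => ξ q.1 q.2) :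
    Measurable fun q : α × β =>
      a q.1 * ENNReal.ofReal (mixtureFactor (R q.1) (V q.1) (m q.1) (ξ (x q.1) q.2)) := by
  have hw : Measurable fun q : α × β => ξ (x q.1) q.2 :=
    hξ.comp ((hx.comp measurable_fst).prodMk measurable_snd)
  unfold mixtureFactor
  fun_prop

variable [IsProbabilityMeasure P]

/-- The supermartingale property: given the past, the new factor has mean at most one, since the
new noise is independent of the past and sub-Gaussian at every fixed point. -/
lemma IsSampling.setLIntegral_mixtureValue_succ_le (h : IsSampling P f ρ ℱ 𝒩 ξ x y)
    (hf : Measurable f) (hκ : ∀ x y, κ x y = inner ℝ (φ x) (φ y)) (hρ : ∀ z, 0 < ρ z)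
    (hκm : Measurable fun q : 𝒳 × 𝒳 => κ q.1 q.2) (hρm : Measurable ρ)
    (n : ℕ) (B : Set Ω) (hB : MeasurableSet[ℱ n] B) :
    ∫⁻ ω in B, ENNReal.ofReal (mixtureValue κ ρ (firstTerms x (n + 1) ω)
        (firstTerms (obsNoise ξ x) (n + 1) ω)) ∂P
      ≤ ∫⁻ ω in B, ENNReal.ofReal (mixtureValue κ ρ (firstTerms x n ω)
        (firstTerms (obsNoise ξ x) n ω)) ∂P := by
  have hp := fun i => h.measurable_firstTerms_point (n := n) i
  have hη := fun i => h.measurable_firstTerms_noise (n := n) hf i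
  have hx := h.point_measurable n
  let a : Ω → ℝ≥0∞ := B.indicator fun ω => ENNReal.ofReal
    (mixtureValue κ ρ (firstTerms x n ω) (firstTerms (obsNoise ξ x) n ω))
  let R : Ω → ℝ := fun ω => ρ (x (n + 1) ω) ^ 2
  let V : Ω → ℝ := fun ω => postVar κ ρ 1 (firstTerms x n ω) (x (n + 1) ω)
  let m : Ω → ℝ := fun ω => postMean κ ρ 1 (firstTerms x n ω) (firstTerms (obsNoise ξ x) n ω)
    (x (n + 1) ω)
  have ha : Measurable[ℱ n] a :=
    (ENNReal.measurable_ofReal.comp (h.measurable_mixtureValue hf hκm hρm n)).indicator hB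
  have hR : Measurable[ℱ n] R := (hρm.comp hx).pow_const 2
  have hV : Measurable[ℱ n] V := measurable_postVar hκm hρm hp hx
  have hm : Measurable[ℱ n] m := measurable_postMean hκm hρm hp hη hx
  have hF := @measurable_mul_mixtureFactor 𝒳 _ Ω Ω (ℱ n) (𝒩 (n + 1)) a R V m (x (n + 1))
    (ξ (n + 1)) ha hR hV hm hx (h.noise_measurable n)
  have hB' : MeasurableSet B := ℱ.le n _ hB
  rw [← lintegral_indicator hB', ← lintegral_indicator hB']
  calc _ = ∫⁻ ω, a ω * ENNReal.ofReal
        (mixtureFactor (R ω) (V ω) (m ω) (ξ (n + 1) (x (n + 1) ω) ω)) ∂P := by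
        refine lintegral_congr fun ω => ?_
        by_cases hω : ω ∈ B
        · simp only [a, Set.indicator_of_mem hω]
          rw [mixtureValue_succ hκ hρ, ENNReal.ofReal_mul (mixtureValue_nonneg _ _)]
          rfl
        · simp [a, hω]
    _ = ∫⁻ ω, ∫⁻ ω', a ω * ENNReal.ofReal
        (mixtureFactor (R ω) (V ω) (m ω) (ξ (n + 1) (x (n + 1) ω) ω')) ∂P ∂P :=
        lintegral_diag_of_indep (ℱ.le n) (h.noise_le n) (h.noise_indep n).symm hF
    _ ≤ ∫⁻ ω, a ω ∂P := by
        refine lintegral_mono fun ω => ?_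
        have hZ : Measurable (ξ (n + 1) (x (n + 1) ω)) :=
          ((h.noise_measurable n).comp (@measurable_prodMk_left _ _ _ (𝒩 (n + 1)) _)).mono
            (h.noise_le n) le_rfl
        have hle := lintegral_mixtureFactor_le_one (R := R ω) (V := V ω) (pow_pos (hρ _) 2)
          (postVar_nonneg hκ hρ _ _) (m ω) hZ (h.noise_subgaussian n (x (n + 1) ω))
        have hmeas : Measurable fun ω' => ENNReal.ofReal
            (mixtureFactor (R ω) (V ω) (m ω) (ξ (n + 1) (x (n + 1) ω) ω')) := by
          unfold mixtureFactor
          fun_prop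
        rw [lintegral_const_mul _ hmeas]
        exact mul_le_of_le_one_right' hle

/-- The time-uniform deviation bound for the self-normalized noise. -/
lemma IsSampling.measure_mixtureValue_gt_le (h : IsSampling P f ρ ℱ 𝒩 ξ x y)
    (hf : Measurable f) (hκ : ∀ x y, κ x y = inner ℝ (φ x) (φ y)) (hρ : ∀ z, 0 < ρ z)
    (hκm : Measurable fun q : 𝒳 × 𝒳 => κ q.1 q.2) (hρm : Measurable ρ) {δ : ℝ} (hδ : 0 < δ) :
    P {ω | ∃ n, 1 / δ < mixtureValue κ ρ (firstTerms x n ω) (firstTerms (obsNoise ξ x) n ω)}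
      ≤ ENNReal.ofReal δ := by
  have hv := mul_measure_exists_gt_le (P := P) (ℱ := ℱ)
    (M := fun n ω => ENNReal.ofReal
      (mixtureValue κ ρ (firstTerms x n ω) (firstTerms (obsNoise ξ x) n ω)))
    (fun n => ENNReal.measurable_ofReal.comp (h.measurable_mixtureValue hf hκm hρm n))
    (h.setLIntegral_mixtureValue_succ_le hf hκ hρ hκm hρm) (ENNReal.ofReal (1 / δ))
  have hδ' : 0 < 1 / δ := by positivity
  simp only [mixtureValue_zero, ENNReal.ofReal_one, lintegral_const, measure_univ, mul_one,
    ENNReal.ofReal_lt_ofReal_iff_of_nonneg hδ'.le] at hv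
  calc _ = ENNReal.ofReal δ * (ENNReal.ofReal (1 / δ) * P {ω | ∃ n, 1 / δ
          < mixtureValue κ ρ (firstTerms x n ω) (firstTerms (obsNoise ξ x) n ω)}) := by
        rw [← mul_assoc, ← ENNReal.ofReal_mul hδ.le, mul_one_div_cancel hδ.ne',
          ENNReal.ofReal_one, one_mul]
    _ ≤ _ := mul_le_of_le_one_right' hv

end Confidence

/-! ### Regret -/

section Regret

variable {𝒳 Ω H : Type*} [NormedAddCommGroup H] [InnerProductSpace ℝ H]
  {κ : 𝒳 → 𝒳 → ℝ} {φ : 𝒳 → H} {ρ : 𝒳 → ℝ}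

/-- A variance is at most `r² + 1` times its information gain: `v ≤ 1` and
`u / (1 + u) ≤ ln (1 + u)` for `u = v / r²`. -/
lemma le_mul_log_one_add {v r : ℝ} (hv0 : 0 ≤ v) (hv1 : v ≤ 1) (hr : 0 < r) :
    v ≤ (r ^ 2 + 1) * Real.log (1 + v / r ^ 2) := by
  have h := Real.one_sub_inv_le_log_of_pos (x := 1 + v / r ^ 2) (by positivity)
  have h' : 1 - (1 + v / r ^ 2)⁻¹ = v / (r ^ 2 + v) := by
    have : r ^ 2 + v ≠ 0 := by positivity
    field_simp
    ring
  calc v = (r ^ 2 + 1) * (v / (r ^ 2 + 1)) := by field_simp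
    _ ≤ (r ^ 2 + 1) * (v / (r ^ 2 + v)) := by gcongr
    _ ≤ _ := by rw [← h']; gcongr

lemma bddAbove_infoGain (hκ : ∀ x y, κ x y = inner ℝ (φ x) (φ y)) (hκ1 : ∀ z, κ z z ≤ 1)
    {r : ℝ} (hr : 0 < r) (hρ : ∀ z, r ≤ ρ z) (T : ℕ) :
    BddAbove (Set.range fun p : Fin T → 𝒳 => infoGain κ ρ 1 p) := by
  have hρ0 : ∀ z, 0 < ρ z := fun z => hr.trans_le (hρ z)
  refine ⟨1 / 2 * ∑ _ : Fin T, Real.log (1 + 1 / r ^ 2), ?_⟩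
  rintro _ ⟨p, rfl⟩
  simp only [infoGain]
  gcongr with t
  · have := postVar_nonneg hκ hρ0 (fun i : Fin (t : ℕ) => p (i.castLE t.isLt.le)) (p t)
    positivity
  · exact (postVar_le hκ hρ0 _ _).trans (hκ1 _)
  · exact hρ _

/-- The posterior variances at the queried points are summable up to the information gain. -/
lemma sum_postVar_le (hκ : ∀ x y, κ x y = inner ℝ (φ x) (φ y)) (hκ1 : ∀ z, κ z z ≤ 1)
    {r s : ℝ} (hr : 0 < r) (hρ : ∀ z, ρ z ∈ Set.Icc r s) (x : ℕ → Ω → 𝒳) (ω : Ω) (T : ℕ) :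
    ∑ t ∈ Finset.range T, postVar κ ρ 1 (firstTerms x t ω) (x (t + 1) ω)
      ≤ (s ^ 2 + 1) * (2 * maxInfoGain κ ρ 1 T) := by
  have hρ0 : ∀ z, 0 < ρ z := fun z => hr.trans_le (hρ z).1
  have hsup : infoGain κ ρ 1 (firstTerms x T ω) ≤ maxInfoGain κ ρ 1 T :=
    le_ciSup (bddAbove_infoGain hκ hκ1 hr (fun z => (hρ z).1) T) _
  have hinfo : infoGain κ ρ 1 (firstTerms x T ω) = 1 / 2 * ∑ t ∈ Finset.range T,
      Real.log (1 + postVar κ ρ 1 (firstTerms x t ω) (x (t + 1) ω) / ρ (x (t + 1) ω) ^ 2) := by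
    rw [← Fin.sum_univ_eq_sum_range (fun t => Real.log (1 + postVar κ ρ 1 (firstTerms x t ω)
      (x (t + 1) ω) / ρ (x (t + 1) ω) ^ 2))]
    rfl
  calc _ ≤ ∑ t ∈ Finset.range T, (s ^ 2 + 1) * Real.log
        (1 + postVar κ ρ 1 (firstTerms x t ω) (x (t + 1) ω) / ρ (x (t + 1) ω) ^ 2) := by
        refine Finset.sum_le_sum fun t _ => ?_
        have h0 := postVar_nonneg hκ hρ0 (firstTerms x t ω) (x (t + 1) ω)
        have hlog : 0 ≤ Real.log
            (1 + postVar κ ρ 1 (firstTerms x t ω) (x (t + 1) ω) / ρ (x (t + 1) ω) ^ 2) :=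
          Real.log_nonneg (le_add_of_nonneg_right (by positivity))
        refine (le_mul_log_one_add h0 ((postVar_le hκ hρ0 _ _).trans (hκ1 _))
          (hρ0 (x (t + 1) ω))).trans ?_
        have := hρ0 (x (t + 1) ω)
        gcongr
        exact (hρ _).2
    _ = (s ^ 2 + 1) * (2 * infoGain κ ρ 1 (firstTerms x T ω)) := by
        rw [hinfo, ← Finset.mul_sum]
        ring
    _ ≤ _ := by gcongr

lemma sum_postStd_le (hκ : ∀ x y, κ x y = inner ℝ (φ x) (φ y)) (hκ1 : ∀ z, κ z z ≤ 1)
    {r s : ℝ} (hr : 0 < r) (hρ : ∀ z, ρ z ∈ Set.Icc r s) (x : ℕ → Ω → 𝒳) (ω : Ω) (T : ℕ) :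
    ∑ t ∈ Finset.range T, postStd κ ρ 1 (firstTerms x t ω) (x (t + 1) ω)
      ≤ √2 * √(T * maxInfoGain κ ρ 1 T * (s ^ 2 + 1)) := by
  rw [← Real.sqrt_mul zero_le_two]
  refine Real.le_sqrt_of_sq_le (sq_sum_le_card_mul_sum_sq.trans ?_)
  have hsq : ∀ t, postStd κ ρ 1 (firstTerms x t ω) (x (t + 1) ω) ^ 2
      = postVar κ ρ 1 (firstTerms x t ω) (x (t + 1) ω) := fun t =>
    Real.sq_sqrt (postVar_nonneg hκ (fun z => hr.trans_le (hρ z).1) _ _)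
  simp only [hsq, Finset.card_range]
  calc _ ≤ (T : ℝ) * ((s ^ 2 + 1) * (2 * maxInfoGain κ ρ 1 T)) := by
        gcongr
        exact sum_postVar_le hκ hκ1 hr hρ x ω T
    _ = _ := by ring

/-- Optimism: if `w` is a valid confidence width and `w ≤ β`, a maximizer of the acquisition
function has regret at most `2 β σ`. -/
lemma meanVar_sub_le {n : ℕ} {f : 𝒳 → ℝ} {α β w : ℝ} {p : Fin n → 𝒳} {v : Fin n → ℝ}
    (hconf : ∀ z, |postMean κ ρ 1 p v z - f z| ≤ w * postStd κ ρ 1 p z) (hw : w ≤ β)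
    {z : 𝒳} (hz : ∀ z', acquisition κ ρ α 1 β p v z' ≤ acquisition κ ρ α 1 β p v z) (z' : 𝒳) :
    meanVar f ρ α z' - meanVar f ρ α z ≤ 2 * β * postStd κ ρ 1 p z := by
  have h₁ := (abs_le.1 (hconf z')).1
  have h₂ := (abs_le.1 (hconf z)).2
  have h₃ := hz z'
  have h₄ := mul_le_mul_of_nonneg_right hw (Real.sqrt_nonneg (postVar κ ρ 1 p z'))
  have h₅ := mul_le_mul_of_nonneg_right hw (Real.sqrt_nonneg (postVar κ ρ 1 p z))
  simp only [acquisition, meanVar, postStd] at *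
  linarith

/-- With either choice of `β_t`, the parameter dominates the width that is valid before round `t`,
and it does not decrease. -/
lemma IsWidthSeq.confWidth_le_and_monotone (hκ : ∀ x y, κ x y = inner ℝ (φ x) (φ y))
    (hρ : ∀ z, 0 < ρ z) {b δ : ℝ} (hδ : 0 < δ) {x : ℕ → Ω → 𝒳} {β : ℕ → Ω → ℝ}
    (hβ : IsWidthSeq κ ρ 1 b δ x β) (ω : Ω) :
    (∀ t, confWidth κ ρ 1 b δ (firstTerms x t ω) ≤ β (t + 1) ω) ∧
      Monotone fun t => β (t + 1) ω := by
  have hmono : Monotone fun t => confWidth κ ρ 1 b δ (firstTerms x t ω) :=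
    monotone_nat_of_le_succ fun t => confWidth_le_succ hκ hρ hδ b (firstTerms x (t + 1) ω)
  rcases hβ with hβ | hβ
  · simp only [hβ]
    exact ⟨fun t => hmono t.le_succ, fun i j hij => hmono (Nat.succ_le_succ hij)⟩
  · simp only [hβ]
    exact ⟨fun t => le_rfl, hmono⟩

lemma cumRegret_eq_sum_range (f ρ : 𝒳 → ℝ) (α : ℝ) (xstar : 𝒳) (x : ℕ → Ω → 𝒳) (T : ℕ) (ω : Ω) :
    cumRegret f ρ α xstar x T ω
      = ∑ t ∈ Finset.range T, (meanVar f ρ α xstar - meanVar f ρ α (x (t + 1) ω)) := by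
  rw [cumRegret, Finset.range_eq_Ico, Finset.sum_Ico_add'
    (fun t => meanVar f ρ α xstar - meanVar f ρ α (x t ω)) 0 T 1]
  rfl

end Regret

end RAHBO

theorem proposition1 :
    -- the constant of the `O` is absolute
    ∃ C : ℝ, 0 < C ∧
    ∀ (d : ℕ) (X : Set (EuclideanSpace ℝ (Fin d))), IsCompact X →
    -- the RKHS of functions on `X`, with kernel at most one
    ∀ (H : Type*) [NormedAddCommGroup H] [InnerProductSpace ℝ H] [CompleteSpace H]
      [RKHS ℝ H X ℝ],
    Measurable (fun q : X × X => RAHBO.scalarKernel H q.1 q.2) →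
    (∀ z z' : X, RAHBO.scalarKernel H z z' ≤ 1) →
    -- the objective, with `b` either `‖f‖` or a known upper bound of it
    ∀ (f : H) (B b : ℝ), ‖f‖ ≤ B → ‖f‖ ≤ b → b ≤ B →
    -- the variance-proxy and the risk tolerance
    ∀ (ρ : X → ℝ) (ϱlow ϱup : ℝ), Measurable ρ → 0 < ϱlow →
    (∀ z, ρ z ∈ Set.Icc ϱlow ϱup) →
    ∀ (α : ℝ), 0 ≤ α →
    ∀ (xstar : X), (∀ z : X, RAHBO.meanVar f ρ α z ≤ RAHBO.meanVar f ρ α xstar) →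
    -- the sampling model
    ∀ (Ω : Type*) [mΩ : MeasurableSpace Ω] (P : Measure Ω) [IsProbabilityMeasure P]
      (ℱ : Filtration ℕ mΩ) (𝒩 : ℕ → MeasurableSpace Ω)
      (ξ : ℕ → X → Ω → ℝ) (x : ℕ → Ω → X) (y : ℕ → Ω → ℝ),
    RAHBO.IsSampling P f ρ ℱ 𝒩 ξ x y →
    -- the algorithm, with `λ = 1`
    ∀ (δ : ℝ), δ ∈ Set.Ioo (0 : ℝ) 1 →
    ∀ (N : ℕ∞) (β : ℕ → Ω → ℝ),
    RAHBO.IsWidthSeq (RAHBO.scalarKernel H) ρ 1 b δ x β →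
    RAHBO.IsRAHBO P (RAHBO.scalarKernel H) ρ α 1 N x y β →
    -- an event of probability at least `1 - δ` on which the regret bound holds
    ∃ E : Set Ω, MeasurableSet E ∧ ENNReal.ofReal (1 - δ) ≤ P E ∧
      ∀ ω ∈ E, ∀ T : ℕ, 1 ≤ T → (T : ℕ∞) ≤ N →
        RAHBO.cumRegret f ρ α xstar x T ω ≤
          C * (β T ω * √(T * RAHBO.maxInfoGain (RAHBO.scalarKernel H) ρ 1 T * (ϱup ^ 2 + 1))) := by
  -- The factor `2` comes from optimism, `√2` from the `1 / 2` in the information gain.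
  refine ⟨2 * √2, by positivity, ?_⟩
  intro d X _ H _ _ _ _ hκm hκ1 f B b _ hfb _ ρ ϱlow ϱup hρm hlow hρ α _ xstar _ Ω mΩ P _ ℱ 𝒩 ξ x y
    hs δ hδ N β hβ hrun
  let φ : X → H := fun z => RKHS.kerFun H z 1
  have hκ : ∀ z z', RAHBO.scalarKernel H z z' = inner ℝ (φ z) (φ z') := fun z z' => by
    rw [real_inner_comm, ← RKHS.kernel_inner, RAHBO.scalarKernel]
    simp
  have hfφ : ∀ z, f z = inner ℝ (φ z) f := fun z => by
    rw [RKHS.kerFun_inner]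
    simp
  have hρ0 : ∀ z, 0 < ρ z := fun z => hlow.trans_le (hρ z).1
  have hdev := hs.measure_mixtureValue_gt_le (RAHBO.measurable_rkhs hκm f) hκ hρ0 hκm hρm hδ.1
  set dev : Set Ω := {ω | ∃ n, 1 / δ < RAHBO.mixtureValue (RAHBO.scalarKernel H) ρ
    (RAHBO.firstTerms x n ω) (RAHBO.firstTerms (RAHBO.obsNoise ξ x) n ω)} with hdevdef
  have hrun' : ∀ᵐ ω ∂P, ∀ t : ℕ, ((t + 1 : ℕ) : ℕ∞) ≤ N → ∀ z : X,
      RAHBO.acquisition (RAHBO.scalarKernel H) ρ α 1 (β (t + 1) ω) (RAHBO.firstTerms x t ω)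
        (RAHBO.firstTerms y t ω) z ≤
      RAHBO.acquisition (RAHBO.scalarKernel H) ρ α 1 (β (t + 1) ω) (RAHBO.firstTerms x t ω)
        (RAHBO.firstTerms y t ω) (x (t + 1) ω) :=
    ae_all_iff.2 fun t => Filter.eventually_imp_distrib_left.2 (hrun t)
  set run : Set Ω := {ω | ∀ t : ℕ, ((t + 1 : ℕ) : ℕ∞) ≤ N → ∀ z : X,
      RAHBO.acquisition (RAHBO.scalarKernel H) ρ α 1 (β (t + 1) ω) (RAHBO.firstTerms x t ω)
        (RAHBO.firstTerms y t ω) z ≤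
      RAHBO.acquisition (RAHBO.scalarKernel H) ρ α 1 (β (t + 1) ω) (RAHBO.firstTerms x t ω)
        (RAHBO.firstTerms y t ω) (x (t + 1) ω)}
  have hnull : P runᶜ = 0 := hrun'
  have hbad : P (toMeasurable P (dev ∪ runᶜ)) ≤ ENNReal.ofReal δ := by
    rw [measure_toMeasurable]
    exact (measure_union_le _ _).trans (by rw [hnull, add_zero]; exact hdev)
  -- The rule of the algorithm holds almost surely on a set that need not be measurable.
  refine ⟨(toMeasurable P (dev ∪ runᶜ))ᶜ, (measurableSet_toMeasurable _ _).compl, ?_, ?_⟩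
  · rw [prob_compl_eq_one_sub (measurableSet_toMeasurable _ _),
      ENNReal.ofReal_sub 1 hδ.1.le, ENNReal.ofReal_one]
    gcongr
  intro ω hω T hT hTN
  have hω' : ω ∉ dev ∪ runᶜ := fun h => hω (subset_toMeasurable _ _ h)
  obtain ⟨hωdev, hωrun⟩ := not_or.1 hω'
  have hωrun : ω ∈ run := not_not.1 hωrun
  have hωdev : ∀ n, RAHBO.mixtureValue (RAHBO.scalarKernel H) ρ
      (RAHBO.firstTerms x n ω) (RAHBO.firstTerms (RAHBO.obsNoise ξ x) n ω) ≤ 1 / δ := fun n =>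
    not_lt.1 fun h => hωdev ⟨n, h⟩
  obtain ⟨hwβ, hβmono⟩ := hβ.confWidth_le_and_monotone hκ hρ0 hδ.1 ω
  obtain ⟨T, rfl⟩ := Nat.exists_eq_add_of_le' hT
  have hβT : 0 ≤ β (T + 1) ω :=
    (add_nonneg (Real.sqrt_nonneg _) (mul_nonneg (Real.sqrt_nonneg 1)
      ((norm_nonneg f).trans hfb))).trans (hwβ T)
  have hconf : ∀ n z, |RAHBO.postMean (RAHBO.scalarKernel H) ρ 1 (RAHBO.firstTerms x n ω)
      (RAHBO.firstTerms y n ω) z - f z| ≤ RAHBO.confWidth (RAHBO.scalarKernel H) ρ 1 b δ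
        (RAHBO.firstTerms x n ω) * RAHBO.postStd (RAHBO.scalarKernel H) ρ 1
        (RAHBO.firstTerms x n ω) z := fun n z => by
    rw [hfφ]
    refine (RAHBO.abs_postMean_sub_le hκ hρ0 _ f _
      (RAHBO.firstTerms (RAHBO.obsNoise ξ x) n ω) (fun i => ?_) z).trans ?_
    · rw [← hfφ]
      exact hs.obs_eq i ω
    · refine mul_le_mul_of_nonneg_right (le_trans ?_ (RAHBO.sqrt_selfNorm_add_le_confWidth hκ hρ0
        hδ.1 b _ _ (hωdev n))) (Real.sqrt_nonneg _)
      gcongr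
  rw [RAHBO.cumRegret_eq_sum_range]
  calc _ ≤ ∑ t ∈ Finset.range (T + 1), 2 * β (T + 1) ω * RAHBO.postStd (RAHBO.scalarKernel H) ρ 1
        (RAHBO.firstTerms x t ω) (x (t + 1) ω) := by
        refine Finset.sum_le_sum fun t ht => ?_
        have htT : t + 1 ≤ T + 1 := Finset.mem_range.1 ht
        refine (RAHBO.meanVar_sub_le (hconf t) (hwβ t)
          (hωrun t ((Nat.cast_le.2 htT).trans hTN)) xstar).trans ?_
        have := hβmono (Nat.le_of_succ_le_succ htT)
        exact mul_le_mul_of_nonneg_right (mul_le_mul_of_nonneg_left this zero_le_two)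
          (Real.sqrt_nonneg _)
    _ ≤ 2 * β (T + 1) ω * (√2 * √(((T + 1 : ℕ) : ℝ)
          * RAHBO.maxInfoGain (RAHBO.scalarKernel H) ρ 1 (T + 1) * (ϱup ^ 2 + 1))) := by
        rw [← Finset.mul_sum]
        gcongr
        exact RAHBO.sum_postStd_le hκ (fun z => hκ1 z z) hlow hρ x ω (T + 1)
    _ = _ := by ring
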